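/- A finite simplicial complex $K$ (a finite geometric simplicial complex in some $\mathbb{R}^n$; the empty complex, of dimension $-1$, is allowed) has vertex set $V(K)$; $f_i(K)$ is the number of its $i$-simplices for $i\ge 0$, $f_{-1}(K)=1$, and its Euler characteristic is $\sum_{i\ge 0}(-1)^i f_i(K)$. The link of $v\in V(K)$ is the subcomplex $\mathrm{link}(v,K)$ of all simplices of $K$ that do not contain $v$ and that together with $v$ span a simplex of $K$. A complex is flag if every nonempty set of vertices that are pairwise joined by edges is the vertex set of a simplex. A $d$-sphere is a complex whose underlying space is piecewise linearly homeomorphic to the boundary of a $(d+1)$-simplex. Let $\mathcal{T}$ be a set of finite simplicial complexes, and let $\mathcal{L}(\mathcal{T})=\{\mathrm{link}(v,K) \mid K\in\mathcal{T},\ v\in V(K)\}$. A function $\Lambda:\mathcal{T}\to\mathbb{R}$ is called combinatorially locally determined if there is a function $h:\mathcal{L}(\mathcal{T})\to\mathbb{R}$ that takes equal values on isomorphic complexes and satisfies $\Lambda(K)=\sum_{v\in V(K)}h(\mathrm{link}(v,K))$ for every $K\in\mathcal{T}$. **Theorem 1.** Let $\mathcal{T}$ be a set of finite simplicial complexes,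 let $b_{-1},b_0,b_1,\ldots\in\mathbb{R}$, and let $\Lambda:\mathcal{T}\to\mathbb{R}$ satisfy $\Lambda(K)=\sum_{i=-1}^{\dim K}b_i f_i(K)$ for all $K\in\mathcal{T}$. 1. If all complexes in $\mathcal{T}$ have the same non-zero Euler characteristic, then $\Lambda$ is combinatorially locally determined. 2. If $b_{-1}=0$, then $\Lambda$ is combinatorially locally determined. 3. If $b_{-1}\ne 0$, and if $\mathcal{T}$ contains all flag $d$-spheres for some odd integer $d\ge 3$, then $\Lambda$ is not combinatorially locally determined. -/

import Mathlib

/-- A finite simplicial complex in some Euclidean space `ℝⁿ`. As in Mathlib, the simplices are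
given by their (nonempty) sets of vertices; the empty complex is allowed. -/
structure FiniteSimplicialComplex where
  /-- the dimension of the ambient Euclidean space -/
  ambientDim : ℕ
  /-- the underlying simplicial complex -/
  complex : Geometry.SimplicialComplex ℝ (EuclideanSpace ℝ (Fin ambientDim))
  /-- there are finitely many simplices -/
  finite_faces : complex.faces.Finite

namespace FiniteSimplicialComplex

/-- The Euclidean space in which the complex lies. -/
abbrev Ambient (K : FiniteSimplicialComplex) : Type := EuclideanSpace ℝ (Fin K.ambientDim)

/-- The nonempty simplices, as sets of vertices. -/
def faces (K : FiniteSimplicialComplex) : Set (Finset K.Ambient) := K.complex.faces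

/-- The underlying space `|K|`. -/
def space (K : FiniteSimplicialComplex) : Set K.Ambient := K.complex.space

theorem finite_vertices (K : FiniteSimplicialComplex) : K.complex.vertices.Finite := by
  have h : (fun x : K.Ambient => ({x} : Finset K.Ambient)) '' K.complex.vertices ⊆
      K.complex.faces := by
    rintro _ ⟨x, hx, rfl⟩
    exact hx
  exact Set.Finite.of_finite_image (K.finite_faces.subset h)
    (Finset.singleton_injective.injOn)

/-- The finite set of vertices. -/
noncomputable def verts (K : FiniteSimplicialComplex) : Finset K.Ambient :=
  K.finite_vertices.toFinset

/-- The dimension of a complex; the empty complex has dimension `-1`. -/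
noncomputable def dim (K : FiniteSimplicialComplex) : ℤ :=
  (K.finite_faces.toFinset.sup Finset.card : ℕ) - 1

/-- `K.f i` is the number of `i`-simplices, with the convention `K.f (-1) = 1`
(and `K.f i = 0` for `i < -1` and for `i > dim K`). -/
noncomputable def f (K : FiniteSimplicialComplex) (i : ℤ) : ℕ :=
  if i = -1 then 1 else {s | s ∈ K.faces ∧ (s.card : ℤ) = i + 1}.ncard

/-- The Euler characteristic, the alternating sum of the numbers of (nonempty) simplices. -/
noncomputable def eulerChar (K : FiniteSimplicialComplex) : ℤ :=
  ∑ i ∈ Finset.Icc 0 K.dim, (-1) ^ i.toNat * (K.f i : ℤ)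

/-- The link of `v` in `K`: the simplices `s` of `K` that do not contain `v` and that together
with `v` span a simplex of `K`. -/
def link (K : FiniteSimplicialComplex) (v : K.Ambient) : FiniteSimplicialComplex where
  ambientDim := K.ambientDim
  complex :=
    { faces := {s | s ∈ K.faces ∧ ∃ hv : v ∉ s, Finset.cons v s hv ∈ K.faces}
      isRelLowerSet_faces := by
        rintro s ⟨hs, hv, hvs⟩
        refine ⟨K.complex.nonempty_of_mem_faces hs, fun t hts ht => ?_⟩
        have hts' : t ⊆ s := hts
        refine ⟨K.complex.down_closed hs hts' ht, fun h => hv (hts' h), ?_⟩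
        exact K.complex.down_closed hvs (Finset.cons_subset_cons.2 hts') (Finset.cons_nonempty _)
      indep := fun hs => K.complex.indep hs.1
      inter_subset_convexHull := fun hs ht => K.complex.inter_subset_convexHull hs.1 ht.1 }
  finite_faces := K.finite_faces.subset fun _ hs => hs.1

/-- Combinatorial equivalence (simplicial isomorphism): a bijection between the vertex sets under
which the simplices correspond to each other. -/
def CombEquiv (K L : FiniteSimplicialComplex) : Prop :=
  ∃ φ : K.verts ≃ L.verts, ∀ s : Finset K.verts,
    s.map (Function.Embedding.subtype _) ∈ K.faces ↔
      (s.map φ.toEmbedding).map (Function.Embedding.subtype _) ∈ L.faces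

/-- Flag complexes: every nonempty set of vertices that are pairwise joined by edges is the set of
vertices of a simplex. -/
def IsFlag (K : FiniteSimplicialComplex) : Prop :=
  ∀ s : Finset K.Ambient, s.Nonempty → s ⊆ K.verts →
    (∀ v ∈ s, ∀ w ∈ s, v ≠ w → ∃ e ∈ K.faces, (e : Set K.Ambient) = {v, w}) → s ∈ K.faces

end FiniteSimplicialComplex

/-- `X` and `Y` are piecewise linearly homeomorphic: there is a homeomorphism `X → Y`, and `X` is
a union of finitely many convex polytopes (convex hulls of finite sets) on each of which the
homeomorphism is affine. -/
def PLHomeomorphic {m n : ℕ} (X : Set (EuclideanSpace ℝ (Fin m)))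
    (Y : Set (EuclideanSpace ℝ (Fin n))) : Prop :=
  ∃ (e : X ≃ₜ Y) (P : Finset (Finset (EuclideanSpace ℝ (Fin m)))),
    X = ⋃ s ∈ P, convexHull ℝ (s : Set (EuclideanSpace ℝ (Fin m))) ∧
    ∀ s ∈ P, ∃ A : EuclideanSpace ℝ (Fin m) →ᵃ[ℝ] EuclideanSpace ℝ (Fin n),
      ∀ x : X, (x : EuclideanSpace ℝ (Fin m)) ∈ convexHull ℝ (s : Set _) →
        (e x : EuclideanSpace ℝ (Fin n)) = A x

/-- The boundary of the standard `(d+1)`-simplex in `ℝ^(d+2)`. -/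
def simplexBoundary (d : ℕ) : Set (EuclideanSpace ℝ (Fin (d + 2))) :=
  {x | (∀ i, 0 ≤ x i) ∧ ∑ i, x i = 1 ∧ ∃ i, x i = 0}

namespace FiniteSimplicialComplex

/-- `K` is a (PL) `d`-sphere: its underlying space is piecewise linearly homeomorphic to the
boundary of a `(d+1)`-simplex (so in particular it is homeomorphic to `S^d`). -/
def IsSphere (d : ℕ) (K : FiniteSimplicialComplex) : Prop :=
  PLHomeomorphic K.space (simplexBoundary d)

/-- The set of all links of vertices of members of `T`. -/
def linksOf (T : Set FiniteSimplicialComplex) : Set FiniteSimplicialComplex :=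
  {L | ∃ K ∈ T, ∃ v ∈ K.verts, L = K.link v}

theorem link_mem_linksOf {T : Set FiniteSimplicialComplex} (K : T) (v : K.1.verts) :
    K.1.link v.1 ∈ linksOf T :=
  ⟨K.1, K.2, v.1, v.2, rfl⟩

/-- `Λ` is combinatorially locally determined by `h`. -/
def IsCombLocallyDeterminedBy (T : Set FiniteSimplicialComplex) (Λ : T → ℝ)
    (h : linksOf T → ℝ) : Prop :=
  (∀ L M : linksOf T, CombEquiv L.1 M.1 → h L = h M) ∧
    ∀ K : T, Λ K = ∑ v : K.1.verts, h ⟨K.1.link v.1, link_mem_linksOf K v⟩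

/-- `Λ` is combinatorially locally determined. -/
def IsCombLocallyDetermined (T : Set FiniteSimplicialComplex) (Λ : T → ℝ) : Prop :=
  ∃ h : linksOf T → ℝ, IsCombLocallyDeterminedBy T Λ h

end FiniteSimplicialComplex

namespace FiniteSimplicialComplex

/-! Double counting incidences between vertices and n-simplices gives ∑_v f_{n-1}(link v) = (n+1)
f_n(K) (`sum_f_link`). Hence every combination ∑_{n≥0} c_n f_n is locally determined, with weights
c_n/(n+1) on the links. This settles b_{-1} = 0. If the Euler characteristic is a constant E ≠ 0,
then b_{-1} = (b_{-1}/E) ∑ (-1)^i f_i is absorbed as well.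

If b_{-1} ≠ 0, local determinacy of Λ would pass to the constant 1. For d = 2m+1 take the joins K_s
of m+1 cycles, the i-th a pentagon or a quadrilateral according to s_i; these are flag d-spheres.
The link of a vertex of cycle i is the join of two points with the other cycles, so its h-value
α_i(s) does not depend on s_i, and 1 = ∑_i n(s_i) α_i(s) with n = 5 or 4. Weight K_s by ∏_j c(s_j),
where c = -4 for a pentagon and 5 for a quadrilateral. Flipping s_i cancels the i-th contributions
(`sum_weight_mul_eq_zero`), so the weighted total is 0; but the weights add up to (5-4)^{m+1} = 1.

The geometric work is to realize K_s as a PL sphere. A linear map taking the cone over a complex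
bijectively onto the boundary of an orthant realizes the complex, after rescaling, as a subdivision
of the boundary of a simplex (`exists_isSphere_isModel`). Such maps come from subdividing a triangle
(`bijOn_cycleMap`) and from an iterated stellar subdivision (`bijOn_joinMap`). -/

/-! ### Face numbers of links -/

theorem mem_verts {K : FiniteSimplicialComplex} {v : K.Ambient} : v ∈ K.verts ↔ {v} ∈ K.faces := by
  simp only [verts, Set.Finite.mem_toFinset]
  exact Iff.rfl

theorem mem_verts_of_mem_faces {K : FiniteSimplicialComplex} {s : Finset K.Ambient}
    (hs : s ∈ K.faces) {v : K.Ambient} (hv : v ∈ s) : v ∈ K.verts :=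
  mem_verts.2 (K.complex.down_closed hs (Finset.singleton_subset_iff.2 hv)
    (Finset.singleton_nonempty v))

theorem mem_faces_link {K : FiniteSimplicialComplex} {v : K.Ambient} {s : Finset K.Ambient} :
    s ∈ (K.link v).faces ↔ s.Nonempty ∧ ∃ hv : v ∉ s, Finset.cons v s hv ∈ K.faces := by
  constructor
  · rintro ⟨h, h'⟩
    exact ⟨K.complex.nonempty_of_mem_faces h, h'⟩
  · rintro ⟨h, hv, h'⟩
    exact ⟨K.complex.down_closed h' (Finset.subset_cons hv) h, hv, h'⟩

theorem f_eq_ncard_finset_verts (K : FiniteSimplicialComplex) {i : ℤ} (hi : i ≠ -1) :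
    K.f i = {s : Finset K.verts | s.map (Function.Embedding.subtype _) ∈ K.faces ∧
      (s.card : ℤ) = i + 1}.ncard := by
  rw [f, if_neg hi, ← Set.ncard_image_of_injective _
    (Finset.map_injective (Function.Embedding.subtype (· ∈ K.verts)))]
  congr 1
  ext t
  constructor
  · rintro ⟨ht, hc⟩
    have : (t.subtype (· ∈ K.verts)).map (Function.Embedding.subtype _) = t :=
      Finset.subtype_map_of_mem fun v hv => mem_verts_of_mem_faces ht hv
    refine ⟨t.subtype (· ∈ K.verts), ⟨this.symm ▸ ht, ?_⟩, this⟩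
    rw [← hc, ← Finset.card_map (Function.Embedding.subtype _), this]
  · rintro ⟨s, ⟨hs, hc⟩, rfl⟩
    exact ⟨hs, by rwa [Finset.card_map]⟩

theorem CombEquiv.f_eq {K L : FiniteSimplicialComplex} (h : CombEquiv K L) (i : ℤ) :
    K.f i = L.f i := by
  obtain ⟨φ, hφ⟩ := h
  by_cases hi : i = -1
  · simp [f, hi]
  rw [K.f_eq_ncard_finset_verts hi, L.f_eq_ncard_finset_verts hi,
    ← Set.ncard_image_of_injective _ (Finset.map_injective φ.toEmbedding)]
  congr 1
  ext t
  constructor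
  · rintro ⟨s, ⟨hs, hc⟩, rfl⟩
    exact ⟨(hφ s).1 hs, by rwa [Finset.card_map]⟩
  · rintro ⟨ht, hc⟩
    have : (t.map φ.symm.toEmbedding).map φ.toEmbedding = t := by
      ext x; simp
    exact ⟨t.map φ.symm.toEmbedding, ⟨(hφ _).2 (by rwa [this]), by rwa [Finset.card_map]⟩, this⟩

theorem f_link_eq_card (K : FiniteSimplicialComplex) {v : K.Ambient} (hv : v ∈ K.verts) (n : ℕ) :
    (K.link v).f ((n : ℤ) - 1) =
      {s ∈ K.finite_faces.toFinset | s.card = n + 1 ∧ v ∈ s}.card := by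
  classical
  have key : (K.link v).f ((n : ℤ) - 1) =
      {t : Finset K.Ambient | ∃ h : v ∉ t, Finset.cons v t h ∈ K.faces ∧ t.card = n}.ncard := by
    rcases Nat.eq_zero_or_pos n with rfl | hn
    -- The convention f_{-1} = 1 matches the empty set, which corresponds to the 0-simplex `{v}`.
    · have : {t : Finset K.Ambient | ∃ h : v ∉ t, Finset.cons v t h ∈ K.faces ∧ t.card = 0} =
          {∅} := by
        ext t
        simp only [Finset.card_eq_zero, Set.mem_ofPred_eq, Set.mem_singleton_iff]
        constructor
        · rintro ⟨_, _, h⟩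
          exact h
        · rintro rfl
          exact ⟨by simp, by simpa using mem_verts.1 hv, rfl⟩
      rw [this]
      simp [f]
    · rw [f, if_neg (by lia)]
      refine congrArg Set.ncard (Set.ext fun (t : Finset K.Ambient) => ?_)
      refine ⟨fun ⟨(h : t ∈ (K.link v).faces), (hc : (t.card : ℤ) = n - 1 + 1)⟩ => ?_,
        fun ⟨h, h', hc⟩ => ⟨mem_faces_link.2 ⟨?_, h, h'⟩, ?_⟩⟩
      · obtain ⟨-, h, h'⟩ := mem_faces_link.1 h
        exact ⟨h, h', by lia⟩
      · exact Finset.card_pos.1 (by lia)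
      · change (t.card : ℤ) = n - 1 + 1
        lia
  rw [key, ← Set.ncard_coe_finset]
  refine Set.ncard_congr (fun t _ => insert v t) ?_ ?_ ?_
  · rintro t ⟨h, h', hc⟩
    rw [Finset.cons_eq_insert] at h'
    simp only [Finset.coe_filter, Set.Finite.mem_toFinset, Set.mem_ofPred_eq]
    exact ⟨h', by rw [Finset.card_insert_of_notMem h, hc], Finset.mem_insert_self _ _⟩
  · rintro s t ⟨hs, -⟩ ⟨ht, -⟩ hst
    rw [← Finset.erase_insert hs, hst, Finset.erase_insert ht]
  · intro s hs
    simp only [Finset.coe_filter, Set.Finite.mem_toFinset, Set.mem_ofPred_eq] at hs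
    obtain ⟨h, hc, hv⟩ := hs
    refine ⟨s.erase v, ⟨Finset.notMem_erase _ _, ?_, ?_⟩, Finset.insert_erase hv⟩
    · rw [Finset.cons_eq_insert, Finset.insert_erase hv]
      exact h
    · rw [Finset.card_erase_of_mem hv, hc]
      rfl

/-- Counts the pairs (v, s) with v a vertex of the n-simplex s in two ways; each s has n + 1
vertices. -/
theorem sum_f_link (K : FiniteSimplicialComplex) (n : ℕ) :
    ∑ v ∈ K.verts, (K.link v).f ((n : ℤ) - 1) = (n + 1) * K.f n := by
  classical
  have hf : K.f n = {s ∈ K.finite_faces.toFinset | s.card = n + 1}.card := by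
    rw [f, if_neg (by lia), ← Set.ncard_coe_finset]
    congr 1
    ext s
    simp only [Set.mem_ofPred_eq, Finset.coe_filter, Set.Finite.mem_toFinset]
    exact and_congr Iff.rfl (by lia)
  rw [hf, Finset.sum_congr rfl fun v hv => K.f_link_eq_card hv n]
  simp only [← Finset.filter_filter]
  refine (Finset.sum_card_bipartiteAbove_eq_sum_card_bipartiteBelow (fun v s => v ∈ s)).trans ?_
  rw [Finset.sum_congr rfl (g := fun _ => n + 1), Finset.sum_const, smul_eq_mul, mul_comm]
  intro s hs
  simp only [Finset.mem_filter, Set.Finite.mem_toFinset] at hs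
  rw [← hs.2, Finset.bipartiteBelow, Finset.filter_mem_eq_inter,
    Finset.inter_eq_right.2 fun v hv => mem_verts_of_mem_faces hs.1 hv]

/-! ### Locally determined combinations of face numbers -/

theorem f_eq_zero_of_dim_lt (K : FiniteSimplicialComplex) {n : ℕ} (h : K.dim < n) : K.f n = 0 := by
  rw [f, if_neg (by lia)]
  refine (congrArg Set.ncard ?_).trans (Set.ncard_empty (Finset K.Ambient))
  refine Set.eq_empty_of_forall_notMem ?_
  rintro s ⟨hs, hc⟩
  have := Finset.le_sup (f := Finset.card) (K.finite_faces.mem_toFinset.2 hs)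
  rw [dim] at h
  lia

theorem sum_Icc_zero_dim (K : FiniteSimplicialComplex) (g : ℤ → ℝ) :
    ∑ i ∈ Finset.Icc 0 K.dim, g i = ∑ n ∈ Finset.range (K.dim + 1).toNat, g n := by
  symm
  refine Finset.sum_bij (fun n _ => (n : ℤ)) ?_ ?_ ?_ ?_
  · intro n hn
    simp at hn ⊢
    lia
  · intro a _ b _ h
    exact_mod_cast h
  · intro i hi
    simp at hi
    exact ⟨i.toNat, by simp; lia, by lia⟩
  · intros
    rfl

/-- Linear combinations of the numbers of nonempty simplices are combinatorially locally
determined. -/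
theorem isCombLocallyDetermined_of_sum (T : Set FiniteSimplicialComplex) (Λ : T → ℝ) (c : ℤ → ℝ)
    (hΛ : ∀ K : T, Λ K = ∑ i ∈ Finset.Icc 0 K.1.dim, c i * (K.1.f i : ℝ)) :
    IsCombLocallyDetermined T Λ := by
  -- A `finsum` lets the weight on `L` be written without reference to `K`. Below it is cut off at
  -- dim K, beyond which the face numbers of the links of `K` vanish.
  refine ⟨fun L => ∑ᶠ n : ℕ, c n / (n + 1) * (L.1.f ((n : ℤ) - 1) : ℝ), ?_, ?_⟩
  · intro L M h
    simp only [h.f_eq]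
  · intro K
    rw [hΛ, sum_Icc_zero_dim]
    have hterm : ∀ v : K.1.verts,
        ∑ᶠ n : ℕ, c n / (n + 1) * ((K.1.link v.1).f ((n : ℤ) - 1) : ℝ) =
        ∑ n ∈ Finset.range (K.1.dim + 1).toNat,
          c n / (n + 1) * ((K.1.link v.1).f ((n : ℤ) - 1) : ℝ) := by
      intro v
      refine finsum_eq_sum_of_support_subset _ ?_
      intro n hn
      by_contra hn'
      have h0 : K.1.f n = 0 := K.1.f_eq_zero_of_dim_lt (by simp at hn'; lia)
      have h1 := K.1.sum_f_link n
      rw [h0, mul_zero, Finset.sum_eq_zero_iff] at h1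
      apply hn
      simp [h1 v.1 v.2]
    simp only [hterm]
    rw [Finset.sum_comm]
    refine Finset.sum_congr rfl fun n _ => ?_
    have h1 := congrArg (fun m : ℕ => (m : ℝ)) (K.1.sum_f_link n)
    push_cast at h1
    rw [← Finset.mul_sum,
      Finset.sum_coe_sort K.1.verts fun v => ((K.1.link v).f ((n : ℤ) - 1) : ℝ), h1]
    field_simp

theorem neg_one_le_dim (K : FiniteSimplicialComplex) : -1 ≤ K.dim := by
  rw [dim]
  lia

theorem sum_Icc_neg_one_dim (K : FiniteSimplicialComplex) (b : ℤ → ℝ) :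
    ∑ i ∈ Finset.Icc (-1) K.dim, b i * (K.f i : ℝ) =
      b (-1) + ∑ i ∈ Finset.Icc 0 K.dim, b i * (K.f i : ℝ) := by
  have : Finset.Icc (-1) K.dim = insert (-1) (Finset.Icc 0 K.dim) := by
    ext i
    have := K.neg_one_le_dim
    simp
    lia
  rw [this, Finset.sum_insert (by simp)]
  simp [f]

theorem isCombLocallyDetermined_of_eulerChar_eq (T : Set FiniteSimplicialComplex) (Λ : T → ℝ)
    (b : ℤ → ℝ) (hΛ : ∀ K : T, Λ K = ∑ i ∈ Finset.Icc (-1) K.1.dim, b i * (K.1.f i : ℝ))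
    {E : ℤ} (hE : E ≠ 0) (hT : ∀ K ∈ T, K.eulerChar = E) : IsCombLocallyDetermined T Λ := by
  -- The constant b_{-1} is rewritten as b_{-1}/E times the Euler characteristic.
  refine isCombLocallyDetermined_of_sum T Λ (fun i => b i + b (-1) / E * (-1) ^ i.toNat) ?_
  intro K
  have h := congrArg (fun m : ℤ => (m : ℝ)) (hT K.1 K.2)
  simp only [eulerChar] at h
  push_cast at h
  have hE' : (E : ℝ) ≠ 0 := by exact_mod_cast hE
  rw [hΛ, sum_Icc_neg_one_dim]
  simp only [add_mul, mul_assoc]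
  rw [Finset.sum_add_distrib, ← Finset.mul_sum, h]
  field_simp
  ring

theorem isCombLocallyDetermined_of_eq_zero (T : Set FiniteSimplicialComplex) (Λ : T → ℝ)
    (b : ℤ → ℝ) (hΛ : ∀ K : T, Λ K = ∑ i ∈ Finset.Icc (-1) K.1.dim, b i * (K.1.f i : ℝ))
    (hb : b (-1) = 0) : IsCombLocallyDetermined T Λ :=
  isCombLocallyDetermined_of_sum T Λ b fun K => by rw [hΛ, sum_Icc_neg_one_dim, hb, zero_add]

/-- If `Λ` is combinatorially locally determined, then so is the constant function `1` when
`b (-1) ≠ 0`. -/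
theorem exists_isCombLocallyDeterminedBy_one (T : Set FiniteSimplicialComplex) (Λ : T → ℝ)
    (b : ℤ → ℝ) (hΛ : ∀ K : T, Λ K = ∑ i ∈ Finset.Icc (-1) K.1.dim, b i * (K.1.f i : ℝ))
    (hb : b (-1) ≠ 0) (h : IsCombLocallyDetermined T Λ) :
    IsCombLocallyDetermined T fun _ => 1 := by
  obtain ⟨h₁, hc₁, hs₁⟩ := h
  obtain ⟨h₂, hc₂, hs₂⟩ := isCombLocallyDetermined_of_sum T
    (fun K => ∑ i ∈ Finset.Icc 0 K.1.dim, b i * (K.1.f i : ℝ)) b fun _ => rfl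
  refine ⟨fun L => (b (-1))⁻¹ * (h₁ L - h₂ L), ?_, ?_⟩
  · intro L M hLM
    simp only [hc₁ L M hLM, hc₂ L M hLM]
  · intro K
    rw [← Finset.mul_sum, Finset.sum_sub_distrib, ← hs₁, ← hs₂, hΛ, sum_Icc_neg_one_dim]
    simp [hb]

/-! ### Flag complexes given by compatibility relations -/

/-- The finite sets whose elements are pairwise related (in particular related to themselves). -/
def IsCompatible {W : Type*} (R : W → W → Prop) (s : Finset W) : Prop :=
  ∀ v ∈ s, ∀ w ∈ s, R v w

/-- `K` is a geometric realization, with vertex map `p`, of the complex on the vertex set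
`{w | R w w}` whose simplices are the nonempty compatible sets of `R`. -/
structure IsModel {W : Type*} (K : FiniteSimplicialComplex) (R : W → W → Prop)
    (p : W → K.Ambient) : Prop where
  inj : ∀ v w, R v v → R w w → p v = p w → v = w
  mem_faces : ∀ t : Finset K.Ambient, t ∈ K.faces ↔
    t.Nonempty ∧ ∃ s : Finset W, IsCompatible R s ∧ (t : Set K.Ambient) = p '' s

/-- The relation on the vertices of the link of `w`. -/
def linkRel {W : Type*} (R : W → W → Prop) (w a b : W) : Prop :=
  a ≠ w ∧ b ≠ w ∧ R w a ∧ R w b ∧ R a b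

/-- The relation on the vertices of a join of complexes. -/
def joinRel {ι α : Type*} (C : ι → α → α → Prop) (v w : ι × α) : Prop :=
  C v.1 v.2 v.2 ∧ C w.1 w.2 w.2 ∧ (v.1 = w.1 → C v.1 v.2 w.2)

namespace IsModel

variable {W W' : Type*} {K L : FiniteSimplicialComplex} {R : W → W → Prop} {R' : W' → W' → Prop}
  {p : W → K.Ambient} {q : W' → L.Ambient}

theorem mem_verts_iff (hK : IsModel K R p) {v : K.Ambient} :
    v ∈ K.verts ↔ ∃ w, R w w ∧ p w = v := by
  rw [mem_verts, hK.mem_faces]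
  constructor
  · rintro ⟨-, s, hs, h⟩
    have : v ∈ p '' s := by simp [← h]
    obtain ⟨w, hw, rfl⟩ := this
    exact ⟨w, hs w hw w hw, rfl⟩
  · rintro ⟨w, hw, rfl⟩
    exact ⟨Finset.singleton_nonempty _, {w}, by simpa [IsCompatible] using hw, by simp⟩

/-- The parametrization of the vertices of a model. -/
noncomputable def vertsEquiv (hK : IsModel K R p) : {w // R w w} ≃ K.verts :=
  Equiv.ofBijective (fun w => ⟨p w.1, hK.mem_verts_iff.2 ⟨w.1, w.2, rfl⟩⟩) <| by
    constructor
    · intro v w h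
      exact Subtype.ext (hK.inj _ _ v.2 w.2 (congrArg Subtype.val h))
    · rintro ⟨v, hv⟩
      obtain ⟨w, hw, rfl⟩ := hK.mem_verts_iff.1 hv
      exact ⟨⟨w, hw⟩, rfl⟩

theorem map_mem_faces (hK : IsModel K R p) (u : Finset {w // R w w}) :
    (u.map hK.vertsEquiv.toEmbedding).map (Function.Embedding.subtype _) ∈ K.faces ↔
      u.Nonempty ∧ ∀ a ∈ u, ∀ b ∈ u, R a.1 b.1 := by
  rw [hK.mem_faces, Finset.map_nonempty, Finset.map_nonempty]
  refine and_congr_right fun _ => ⟨?_, fun h => ?_⟩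
  · rintro ⟨s, hs, h⟩ a ha b hb
    have hmem : ∀ c ∈ u, c.1 ∈ s := by
      intro c hc
      have : p c.1 ∈ p '' s := by
        rw [← h]
        simp only [Finset.coe_map, Set.mem_image, Finset.mem_coe]
        exact ⟨_, ⟨c, hc, rfl⟩, rfl⟩
      obtain ⟨d, hd, hdc⟩ := this
      rwa [← hK.inj d c.1 (hs d hd d hd) c.2 hdc]
    exact hs _ (hmem a ha) _ (hmem b hb)
  · refine ⟨u.map (Function.Embedding.subtype _), ?_, ?_⟩
    · intro v hv w hw
      obtain ⟨a, ha, rfl⟩ := Finset.mem_map.1 hv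
      obtain ⟨b, hb, rfl⟩ := Finset.mem_map.1 hw
      exact h a ha b hb
    · simp only [Finset.coe_map, Set.image_image]
      rfl

theorem combEquiv (hK : IsModel K R p) (hL : IsModel L R' q) (e : W ≃ W')
    (he : ∀ a b, R a b ↔ R' (e a) (e b)) : CombEquiv K L := by
  let e' : {w // R w w} ≃ {w // R' w w} := e.subtypeEquiv fun a => he a a
  refine ⟨(hK.vertsEquiv.symm.trans e').trans hL.vertsEquiv, fun s => ?_⟩
  obtain ⟨u, rfl⟩ : ∃ u : Finset {w // R w w}, s = u.map hK.vertsEquiv.toEmbedding :=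
    ⟨s.map hK.vertsEquiv.symm.toEmbedding, by ext; simp⟩
  have hu : (u.map hK.vertsEquiv.toEmbedding).map
      ((hK.vertsEquiv.symm.trans e').trans hL.vertsEquiv).toEmbedding =
      (u.map e'.toEmbedding).map hL.vertsEquiv.toEmbedding := by
    simp only [Finset.map_map]
    congr 1
    ext a
    simp
  rw [hu, hK.map_mem_faces, hL.map_mem_faces, Finset.map_nonempty]
  refine and_congr_right fun _ => ?_
  simp only [Finset.mem_map_equiv, e'.forall_congr_left]
  simp [he, e']

theorem link (hK : IsModel K R p) (hR : ∀ a b, R a b → R b a) {w : W} (hw : R w w) :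
    IsModel (K.link (p w)) (linkRel R w) p := by
  classical
  refine ⟨fun a b ha hb h => hK.inj a b ha.2.2.2.2 hb.2.2.2.2 h, fun (t : Finset K.Ambient) => ?_⟩
  refine mem_faces_link.trans (and_congr_right fun _ => ?_)
  constructor
  · rintro ⟨hwt, ht⟩
    obtain ⟨-, s, hs, h⟩ := (hK.mem_faces _).1 ht
    have hws : w ∈ s := by
      have : p w ∈ p '' s := by simp [← h]
      obtain ⟨a, ha, haw⟩ := this
      rwa [← hK.inj a w (hs a ha a ha) hw haw]
    refine ⟨s.erase w, ?_, ?_⟩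
    · intro a ha b hb
      obtain ⟨ha', ha⟩ := Finset.mem_erase.1 ha
      obtain ⟨hb', hb⟩ := Finset.mem_erase.1 hb
      exact ⟨ha', hb', hs _ hws _ ha, hs _ hws _ hb, hs _ ha _ hb⟩
    · ext x
      constructor
      · intro hx
        have : x ∈ p '' s := by
          rw [← h, Finset.coe_cons]
          exact Or.inr hx
        obtain ⟨a, ha, rfl⟩ := this
        refine ⟨a, Finset.mem_erase.2 ⟨?_, ha⟩, rfl⟩
        rintro rfl
        exact hwt hx
      · rintro ⟨a, ha, rfl⟩
        obtain ⟨ha', ha⟩ := Finset.mem_erase.1 ha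
        have : p a ∈ ((Finset.cons (p w) t hwt : Finset K.Ambient) : Set K.Ambient) := by
          rw [h]
          exact ⟨a, ha, rfl⟩
        rw [Finset.coe_cons] at this
        exact this.resolve_left fun h' => ha' (hK.inj _ _ (hs a ha a ha) hw h')
  · rintro ⟨s, hs, h⟩
    have h : (t : Set K.Ambient) = p '' s := h
    have hwt : p w ∉ t := by
      intro hwt
      have : p w ∈ p '' s := by rw [← h]; exact hwt
      obtain ⟨a, ha, haw⟩ := this
      have := hs a ha a ha
      exact this.1 (hK.inj _ _ this.2.2.2.2 hw haw)
    refine ⟨hwt, (hK.mem_faces _).2 ⟨Finset.cons_nonempty _, insert w s, ?_, ?_⟩⟩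
    · intro a ha b hb
      rcases Finset.mem_insert.1 ha with ha' | ha' <;>
        rcases Finset.mem_insert.1 hb with hb' | hb'
      · rwa [ha', hb']
      · rw [ha']
        exact (hs b hb' b hb').2.2.1
      · rw [hb']
        exact hR _ _ (hs a ha' a ha').2.2.1
      · exact (hs a ha' b hb').2.2.2.2
    · rw [Finset.coe_cons, h, Finset.coe_insert, Set.image_insert_eq]

/-- Simplices are exactly the pairwise compatible sets, so only edges need to be inspected. -/
theorem isFlag (hK : IsModel K R p) : K.IsFlag := by
  classical
  intro t ht hv he
  have : Nonempty W := by
    obtain ⟨v, hv'⟩ := ht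
    exact ⟨(hK.mem_verts_iff.1 (hv hv')).choose⟩
  choose! g hg using fun v (hv' : v ∈ t) => hK.mem_verts_iff.1 (hv hv')
  refine (hK.mem_faces t).2 ⟨ht, t.image g, ?_, ?_⟩
  · intro a ha b hb
    obtain ⟨v, hv', rfl⟩ := Finset.mem_image.1 ha
    obtain ⟨w, hw', rfl⟩ := Finset.mem_image.1 hb
    by_cases hvw : v = w
    · subst hvw
      exact (hg v hv').1
    obtain ⟨e, he, hevw⟩ := he v hv' w hw' hvw
    obtain ⟨-, s, hs, h⟩ := (hK.mem_faces e).1 he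
    have hmem : ∀ x ∈ t, x ∈ e → g x ∈ s := by
      intro x hx hxe
      have : x ∈ p '' s := by rw [← h]; exact hxe
      obtain ⟨a, ha, hax⟩ := this
      rwa [← hK.inj a (g x) (hs a ha a ha) (hg x hx).1 (hax.trans (hg x hx).2.symm)]
    refine hs _ (hmem v hv' ?_) _ (hmem w hw' ?_) <;> rw [← Finset.mem_coe, hevw] <;> simp
  · rw [Finset.coe_image, Set.image_image, Set.image_congr fun v hv' => (hg v hv').2, Set.image_id']

end IsModel

/-! ### From linear maps on cones to subdivided simplex boundaries -/

/-- The cone over the geometric realization of the complex of compatible sets. -/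
def cone {W : Type*} (R : W → W → Prop) : Set (W → ℝ) :=
  {x | (∀ w, 0 ≤ x w) ∧ ∀ v w, x v ≠ 0 → x w ≠ 0 → R v w}

/-- The boundary of the nonnegative orthant. -/
def orthantBoundary (J : Type*) : Set (J → ℝ) :=
  {y | (∀ j, 0 ≤ y j) ∧ ∃ j, y j = 0}

theorem single_mem_cone {W : Type*} [DecidableEq W] {R : W → W → Prop} {w : W} (hw : R w w) :
    Pi.single w 1 ∈ cone R := by
  refine ⟨fun v => ?_, fun v v' hv hv' => ?_⟩
  · by_cases h : v = w
    · subst h; simp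
    · simp [h]
  · have : ∀ u, (Pi.single w 1 : W → ℝ) u ≠ 0 → u = w := fun u hu => by
      by_contra h
      simp [h] at hu
    rw [this v hv, this v' hv']
    exact hw

theorem smul_mem_cone {W : Type*} {R : W → W → Prop} {x g : W → ℝ} (hx : x ∈ cone R)
    (hg : ∀ w, R w w → 0 < g w) : (fun w => x w * g w) ∈ cone R := by
  refine ⟨fun w => ?_, fun v w hv hw => hx.2 v w (left_ne_zero_of_mul hv) (left_ne_zero_of_mul hw)⟩
  by_cases h : x w = 0
  · simp [h]
  · exact mul_nonneg (hx.1 w) (hg w (hx.2 w w h h)).le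

theorem map_eq_sum_single {W E : Type*} [Fintype W] [DecidableEq W] [AddCommGroup E] [Module ℝ E]
    (N : (W → ℝ) →ₗ[ℝ] E) (x : W → ℝ) : N x = ∑ w, x w • N (Pi.single w 1) := by
  rw [LinearMap.pi_apply_eq_sum_univ N x]
  refine Finset.sum_congr rfl fun w _ => ?_
  congr 2
  ext i
  simp [Pi.single_apply, eq_comm]

/-- Rescaling each vertex ray so that its image has coordinate sum 1 makes the slice ∑ x = 1 of the
cone correspond to the slice of the orthant boundary, which is the simplex boundary. -/
theorem exists_normalized {W : Type*} [Fintype W] [DecidableEq W] {R : W → W → Prop} {d : ℕ}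
    {M : (W → ℝ) →ₗ[ℝ] (Fin (d + 2) → ℝ)}
    (hM : Set.BijOn M (cone R) (orthantBoundary (Fin (d + 2)))) :
    ∃ N : (W → ℝ) →ₗ[ℝ] EuclideanSpace ℝ (Fin (d + 2)), Set.InjOn N (cone R) ∧
      N '' {x | x ∈ cone R ∧ ∑ w, x w = 1} = simplexBoundary d := by
  let g : W → ℝ := fun w => ∑ j, M (Pi.single w 1) j
  have hg : ∀ w, R w w → 0 < g w := by
    intro w hw
    have hmem := hM.mapsTo (single_mem_cone hw)
    -- If the sum were 0, `M` would send the vertex ray to 0, against injectivity on the cone.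
    refine lt_of_le_of_ne (Finset.sum_nonneg fun j _ => hmem.1 j) fun h0 => ?_
    have h1 := (Finset.sum_eq_zero_iff_of_nonneg fun j _ => hmem.1 j).1 h0.symm
    have h2 : M (Pi.single w 1) = M 0 := by
      rw [map_zero]
      exact funext fun j => h1 j (Finset.mem_univ j)
    have h3 := hM.injOn (single_mem_cone hw) (by simp [cone]) h2
    simpa using congrFun h3 w
  have hsum : ∀ x : W → ℝ, ∑ j, M x j = ∑ w, x w * g w := by
    intro x
    conv_lhs => rw [map_eq_sum_single M x]
    simp only [Finset.sum_apply, Pi.smul_apply, smul_eq_mul]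
    rw [Finset.sum_comm]
    refine Finset.sum_congr rfl fun w _ => ?_
    rw [← Finset.mul_sum]
  let D : (W → ℝ) →ₗ[ℝ] (W → ℝ) :=
    { toFun := fun x w => x w * (g w)⁻¹
      map_add' := fun x y => funext fun w => add_mul _ _ _
      map_smul' := fun c x => funext fun w => mul_assoc _ _ _ }
  have hD : ∀ x ∈ cone R, D x ∈ cone R := fun x hx =>
    smul_mem_cone hx fun w hw => inv_pos.2 (hg w hw)
  have hDg : ∀ x ∈ cone R, ∀ w, D x w * g w = x w := by
    intro x hx w
    by_cases h : x w = 0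
    · simp [D, h]
    · have := (hg w (hx.2 w w h h)).ne'
      simp [D, this]
  refine ⟨(WithLp.linearEquiv 2 ℝ (Fin (d + 2) → ℝ)).symm.toLinearMap ∘ₗ M ∘ₗ D, ?_, ?_⟩
  · intro x hx y hy hxy
    have h1 : M (D x) = M (D y) := (WithLp.linearEquiv 2 ℝ (Fin (d + 2) → ℝ)).symm.injective hxy
    have h2 := hM.injOn (hD x hx) (hD y hy) h1
    ext w
    rw [← hDg x hx, h2, hDg y hy]
  · ext y
    constructor
    · rintro ⟨x, ⟨hx, hx1⟩, rfl⟩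
      have h := hM.mapsTo (hD x hx)
      refine ⟨h.1, ?_, h.2⟩
      have h' := hsum (D x)
      simp only [hDg x hx, hx1] at h'
      exact h'
    · rintro ⟨h0, h1, h2⟩
      obtain ⟨x, hx, hxy⟩ := hM.surjOn (show y.ofLp ∈ orthantBoundary _ from ⟨h0, h2⟩)
      have hDx : D (fun w => x w * g w) = x := by
        ext w
        by_cases h : x w = 0
        · simp [D, h]
        · have := (hg w (hx.2 w w h h)).ne'
          simp [D, this]
      refine ⟨fun w => x w * g w, ⟨smul_mem_cone hx hg, ?_⟩, ?_⟩
      · rw [← hsum, hxy]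
        exact h1
      · simp only [LinearMap.comp_apply, hDx, hxy]
        rfl

section Realization

variable {W : Type*} [Fintype W] [DecidableEq W] {R : W → W → Prop} {n : ℕ}
  {N : (W → ℝ) →ₗ[ℝ] EuclideanSpace ℝ (Fin n)}

theorem injOn_single {W : Type*} [DecidableEq W] {R : W → W → Prop} {n : ℕ}
    {N : (W → ℝ) →ₗ[ℝ] EuclideanSpace ℝ (Fin n)} (hN : Set.InjOn N (cone R)) :
    Set.InjOn (fun w => N (Pi.single w 1)) {w | R w w} := by
  intro v hv w hw h
  have := hN (single_mem_cone hv) (single_mem_cone hw) h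
  by_contra hvw
  have h' := congrFun this v
  simp [hvw] at h'

theorem mem_convexHull_image_iff (hN : Set.InjOn N (cone R)) {s : Finset W}
    (hs : IsCompatible R s) {y : EuclideanSpace ℝ (Fin n)} :
    y ∈ convexHull ℝ ((fun w => N (Pi.single w 1)) '' (s : Set W)) ↔
      ∃ x : W → ℝ, (∀ w, 0 ≤ x w) ∧ (∀ w, w ∉ s → x w = 0) ∧ ∑ w, x w = 1 ∧ N x = y := by
  classical
  have hinj : Set.InjOn (fun w => N (Pi.single w 1)) (s : Set W) :=
    (injOn_single hN).mono fun w hw => hs w hw w hw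
  constructor
  · intro hy
    rw [← Finset.coe_image, Finset.mem_convexHull'] at hy
    obtain ⟨a, ha0, ha1, hay⟩ := hy
    rw [Finset.sum_image hinj] at ha1 hay
    refine ⟨fun w => if w ∈ s then a (N (Pi.single w 1)) else 0, fun w => ?_, fun w hw => ?_, ?_, ?_⟩
    · dsimp only
      split_ifs with h
      · exact ha0 _ (Finset.mem_image_of_mem _ h)
      · exact le_rfl
    · simp [hw]
    · simpa using ha1
    · rw [map_eq_sum_single]
      simpa [ite_smul] using hay
  · rintro ⟨x, h0, hs0, h1, rfl⟩
    rw [map_eq_sum_single, ← Finset.sum_subset (Finset.subset_univ s)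
      fun w _ hw => by simp [hs0 w hw]]
    refine (convex_convexHull ℝ _).sum_mem (fun w _ => h0 w) ?_
      fun w hw => subset_convexHull ℝ _ ⟨w, hw, rfl⟩
    rw [← h1]
    exact Finset.sum_subset (Finset.subset_univ s) fun w _ hw => hs0 w hw

theorem mem_cone_of_isCompatible {W : Type*} {R : W → W → Prop} {s : Finset W} (hs : IsCompatible R s) {x : W → ℝ}
    (h0 : ∀ w, 0 ≤ x w) (hx : ∀ w, w ∉ s → x w = 0) : x ∈ cone R :=
  ⟨h0, fun v w hv hw => hs v (by_contra fun h => hv (hx v h)) w (by_contra fun h => hw (hx w h))⟩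

/-- The positive and negative parts of a linear dependence both lie in the cone and have the same
image, so they coincide and the dependence is trivial. -/
theorem affineIndependent_single (hN : Set.InjOn N (cone R)) {s : Finset W}
    (hs : IsCompatible R s) : AffineIndependent ℝ (fun w : s => N (Pi.single w.1 1)) := by
  rw [affineIndependent_iff]
  intro u c _ hc
  let c' : W → ℝ := fun w => if h : w ∈ s then (if ⟨w, h⟩ ∈ u then c ⟨w, h⟩ else 0) else 0
  have hc's : ∀ w, w ∉ s → c' w = 0 := fun w hw => by simp [c', hw]
  have hNc' : N c' = 0 := by
    rw [map_eq_sum_single, ← Finset.sum_subset (Finset.subset_univ s)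
      fun w _ hw => by simp [hc's w hw], ← hc, ← Finset.sum_coe_sort s,
      ← Finset.sum_subset (Finset.subset_univ u)]
    · refine Finset.sum_congr rfl fun w hw => ?_
      simp [c', hw]
    · intro w _ hw
      simp [c', hw]
  have hparts : N (fun w => max (c' w) 0) = N (fun w => max (-c' w) 0) := by
    rw [← sub_eq_zero, ← map_sub, ← hNc']
    congr 1
    ext w
    exact max_zero_sub_eq_self (c' w)
  have heq := hN
    (mem_cone_of_isCompatible hs (fun w => le_max_right _ _) fun w hw => by simp [hc's w hw])
    (mem_cone_of_isCompatible hs (fun w => le_max_right _ _) fun w hw => by simp [hc's w hw]) hparts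
  intro w hw
  have h1 : max (c' w) 0 = max (-c' w) 0 := congrFun heq w
  have h2 : c' w = 0 := by
    rw [← max_zero_sub_eq_self (c' w), h1, sub_self]
  simpa [c', hw] using h2

/-- The geometric realization given by a linear map that is injective on the cone. -/
noncomputable def realization (hN : Set.InjOn N (cone R)) : FiniteSimplicialComplex where
  ambientDim := n
  complex :=
    { faces := {t | t.Nonempty ∧ ∃ s : Finset W, IsCompatible R s ∧
        (t : Set (EuclideanSpace ℝ (Fin n))) = (fun w => N (Pi.single w 1)) '' s}
      isRelLowerSet_faces := by
        classical
        rintro t ⟨ht, s, hs, hts⟩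
        refine ⟨ht, fun t' ht' hne => ⟨hne, s.filter fun w => N (Pi.single w 1) ∈ t', ?_, ?_⟩⟩
        · intro v hv w hw
          exact hs v (Finset.mem_filter.1 hv).1 w (Finset.mem_filter.1 hw).1
        · ext x
          constructor
          · intro hx
            have : x ∈ (t : Set (EuclideanSpace ℝ (Fin n))) := ht' hx
            rw [hts] at this
            obtain ⟨w, hw, rfl⟩ := this
            exact ⟨w, Finset.mem_coe.2 (Finset.mem_filter.2 ⟨hw, hx⟩), rfl⟩
          · rintro ⟨w, hw, rfl⟩
            exact (Finset.mem_filter.1 (Finset.mem_coe.1 hw)).2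
      indep := by
        rintro t ⟨-, s, hs, hts⟩
        have h := (affineIndependent_single hN hs).range
        have hr : Set.range (fun w : s => N (Pi.single w.1 1)) =
            (t : Set (EuclideanSpace ℝ (Fin n))) := by
          rw [hts]
          ext x
          simp
        rw [hr] at h
        exact h
      inter_subset_convexHull := by
        classical
        rintro t t' ⟨-, s, hs, hts⟩ ⟨-, s', hs', hts'⟩ y ⟨hy, hy'⟩
        rw [hts] at hy
        rw [hts'] at hy'
        obtain ⟨x, hx0, hxs, hx1, rfl⟩ := (mem_convexHull_image_iff hN hs).1 hy
        obtain ⟨x', hx0', hxs', hx1', hxx'⟩ := (mem_convexHull_image_iff hN hs').1 hy'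
        -- A common point has unique cone coordinates, hence is supported on `s ∩ s'`.
        obtain rfl := hN (mem_cone_of_isCompatible hs' hx0' hxs')
          (mem_cone_of_isCompatible hs hx0 hxs) hxx'
        have hcomp : IsCompatible R (s ∩ s') := fun v hv w hw =>
          hs v (Finset.mem_inter.1 hv).1 w (Finset.mem_inter.1 hw).1
        refine convexHull_mono ?_ ((mem_convexHull_image_iff hN hcomp).2 ⟨x', hx0, ?_, hx1, rfl⟩)
        · rw [hts, hts']
          rintro _ ⟨w, hw, rfl⟩
          rw [Finset.mem_coe, Finset.mem_inter] at hw
          exact ⟨⟨w, hw.1, rfl⟩, ⟨w, hw.2, rfl⟩⟩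
        · intro w hw
          by_cases hws : w ∈ s
          · exact hxs' w fun h => hw (Finset.mem_inter.2 ⟨hws, h⟩)
          · exact hxs w hws }
  finite_faces := by
    classical
    refine Set.Finite.subset
      (Set.finite_range fun s : Finset W => s.image fun w => N (Pi.single w 1)) ?_
    rintro t ⟨-, s, -, hts⟩
    refine ⟨s, Finset.coe_injective ?_⟩
    rw [hts, Finset.coe_image]

theorem isModel_realization (hN : Set.InjOn N (cone R)) :
    IsModel (realization hN) R fun w => N (Pi.single w 1) :=
  ⟨fun _ _ hv hw h => injOn_single hN hv hw h, fun _ => Iff.rfl⟩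

theorem space_realization (hN : Set.InjOn N (cone R)) :
    (realization hN).space = N '' {x | x ∈ cone R ∧ ∑ w, x w = 1} := by
  classical
  have hmem : ∀ y, y ∈ (realization hN).space ↔ ∃ t : Finset (EuclideanSpace ℝ (Fin n)),
      (t.Nonempty ∧ ∃ s : Finset W, IsCompatible R s ∧
        (t : Set (EuclideanSpace ℝ (Fin n))) = (fun w => N (Pi.single w 1)) '' s) ∧
      y ∈ convexHull ℝ (t : Set (EuclideanSpace ℝ (Fin n))) := fun y =>
    Geometry.SimplicialComplex.mem_space_iff
  ext y
  refine (hmem y).trans ?_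
  constructor
  · rintro ⟨t, ⟨-, s, hs, hts⟩, hy⟩
    rw [hts] at hy
    obtain ⟨x, hx0, hxs, hx1, rfl⟩ := (mem_convexHull_image_iff hN hs).1 hy
    exact ⟨x, ⟨mem_cone_of_isCompatible hs hx0 hxs, hx1⟩, rfl⟩
  · rintro ⟨x, ⟨hx, hx1⟩, rfl⟩
    -- The support of a cone point is the simplex that carries it.
    let s : Finset W := Finset.univ.filter fun w => x w ≠ 0
    have hs : IsCompatible R s := fun v hv w hw =>
      hx.2 v w (Finset.mem_filter.1 hv).2 (Finset.mem_filter.1 hw).2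
    refine ⟨s.image fun w => N (Pi.single w 1), ⟨?_, s, hs, Finset.coe_image⟩, ?_⟩
    · rw [Finset.image_nonempty]
      by_contra h
      rw [Finset.not_nonempty_iff_eq_empty, Finset.filter_eq_empty_iff] at h
      have : ∑ w, x w = 0 := Finset.sum_eq_zero fun w hw => not_not.1 (h hw)
      linarith
    · rw [Finset.coe_image]
      refine (mem_convexHull_image_iff hN hs).2 ⟨x, hx.1, fun w hw => ?_, hx1, rfl⟩
      by_contra h
      exact hw (Finset.mem_filter.2 ⟨Finset.mem_univ _, h⟩)

/-- The identity is the PL homeomorphism, with the simplices as polytopes. -/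
theorem isSphere_of_space_eq {d : ℕ} (hN : Set.InjOn N (cone R)) (hn : n = d + 2)
    (h : hn ▸ (realization hN).space = simplexBoundary d) : (realization hN).IsSphere d := by
  subst hn
  refine ⟨Homeomorph.setCongr h, (realization hN).finite_faces.toFinset, ?_, ?_⟩
  · simp only [Set.Finite.mem_toFinset]
    rfl
  · intro s _
    exact ⟨AffineMap.id ℝ _, fun x _ => rfl⟩

end Realization

/-- A linear isomorphism from the cone onto the boundary of an orthant yields a realization of the
complex as a subdivision of the boundary of a simplex. -/
theorem exists_isSphere_isModel {W : Type*} [Fintype W] [DecidableEq W] {R : W → W → Prop} {d : ℕ}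
    {M : (W → ℝ) →ₗ[ℝ] (Fin (d + 2) → ℝ)}
    (hM : Set.BijOn M (cone R) (orthantBoundary (Fin (d + 2)))) :
    ∃ (K : FiniteSimplicialComplex) (p : W → K.Ambient), K.IsSphere d ∧ IsModel K R p := by
  obtain ⟨N, hN, hspace⟩ := exists_normalized hM
  exact ⟨realization hN, _, isSphere_of_space_eq hN rfl ((space_realization hN).trans hspace),
    isModel_realization hN⟩

/-! ### Joins of quadrilaterals and pentagons as spheres -/

theorem mem_cone_joinRel_iff {ι α : Type*} {C : ι → α → α → Prop} {x : ι × α → ℝ} :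
    x ∈ cone (joinRel C) ↔ ∀ i, (fun a => x (i, a)) ∈ cone (C i) := by
  constructor
  · intro h i
    exact ⟨fun a => h.1 _, fun a b ha hb => (h.2 _ _ ha hb).2.2 rfl⟩
  · intro h
    refine ⟨fun w => (h w.1).1 w.2, ?_⟩
    rintro ⟨i, a⟩ ⟨j, b⟩ ha hb
    refine ⟨(h i).2 a a ha ha, (h j).2 b b hb hb, ?_⟩
    rintro (rfl : i = j)
    exact (h i).2 a b ha hb

/-- The compatibility relation of a cycle: the pentagon with vertices `0, 1, 2, 3, 4` for `true`,
the quadrilateral with vertices `0, 1, 2, 4` for `false`. -/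
def cycleRel (b : Bool) (x y : Fin 5) : Prop :=
  if b then x = y ∨ y = x + 1 ∨ x = y + 1
  else (x ≠ 3 ∧ y ≠ 3) ∧ (x = y ∨ y = x + 1 ∨ x = y + 1 ∨ x = 2 ∧ y = 4 ∨ x = 4 ∧ y = 2)

instance (b : Bool) (x y : Fin 5) : Decidable (cycleRel b x y) := by
  unfold cycleRel
  infer_instance

/-- The pentagon as a subdivision of a triangle, with the vertices `1` and `3` subdividing two
edges. -/
def cycleMap : (Fin 5 → ℝ) →ₗ[ℝ] (Fin 3 → ℝ) where
  toFun x := ![x 0 + x 1, x 1 + x 2 + x 3, x 3 + x 4]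
  map_add' x y := by
    ext i
    fin_cases i <;> simp <;> ring
  map_smul' c x := by
    ext i
    fin_cases i <;> simp <;> ring

theorem exists_eq_zero_iff {y : Fin 3 → ℝ} : (∃ j, y j = 0) ↔ y 0 = 0 ∨ y 1 = 0 ∨ y 2 = 0 := by
  constructor
  · rintro ⟨j, hj⟩
    fin_cases j <;> simp_all
  · rintro (h | h | h) <;> exact ⟨_, h⟩

theorem eq_zero_or_of_mem_cone {W : Type*} {R : W → W → Prop} {x : W → ℝ} (hx : x ∈ cone R)
    (v w : W) (h : ¬ R v w) : x v = 0 ∨ x w = 0 := by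
  by_contra! h'
  exact h (hx.2 v w h'.1 h'.2)

/-- The coordinates with respect to the cone over a cycle. -/
noncomputable def cycleCoord (b : Bool) (z : Fin 3 → ℝ) : Fin 5 → ℝ :=
  let m := min (z 0) (z 1)
  let m' := if b then min (z 1) (z 2) else 0
  ![z 0 - m, m, z 1 - m - m', m', z 2 - m']

/-- Vertices 0, 2, 4 go to the corners of a triangle, 1 and 3 to sums of two corners. On the edge
cut by 1 the coordinate of 1 is the minimum of the two corner coordinates, and likewise for 3; this
inverts the map. -/
theorem bijOn_cycleMap (b : Bool) :
    Set.BijOn cycleMap (cone (cycleRel b)) (orthantBoundary (Fin 3)) := by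
  have hmaps : Set.MapsTo cycleMap (cone (cycleRel b)) (orthantBoundary (Fin 3)) := by
    intro x hx
    have h0 := hx.1 0
    have h1 := hx.1 1
    have h2 := hx.1 2
    have h3 := hx.1 3
    have h4 := hx.1 4
    refine ⟨fun j => ?_, exists_eq_zero_iff.2 ?_⟩
    · fin_cases j <;> simp [cycleMap] <;> linarith
    · have h02 := eq_zero_or_of_mem_cone hx 0 2 (by cases b <;> decide)
      have h03 := eq_zero_or_of_mem_cone hx 0 3 (by cases b <;> decide)
      have h13 := eq_zero_or_of_mem_cone hx 1 3 (by cases b <;> decide)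
      have h14 := eq_zero_or_of_mem_cone hx 1 4 (by cases b <;> decide)
      simp only [cycleMap, LinearMap.coe_mk, AddHom.coe_mk, Matrix.cons_val]
      grind
  have hleft : Set.LeftInvOn (cycleCoord b) cycleMap (cone (cycleRel b)) := by
    intro x hx
    have h0 := hx.1 0
    have h1 := hx.1 1
    have h2 := hx.1 2
    have h3 := hx.1 3
    have h4 := hx.1 4
    have h02 := eq_zero_or_of_mem_cone hx 0 2 (by cases b <;> decide)
    have h03 := eq_zero_or_of_mem_cone hx 0 3 (by cases b <;> decide)
    have h13 := eq_zero_or_of_mem_cone hx 1 3 (by cases b <;> decide)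
    have h14 := eq_zero_or_of_mem_cone hx 1 4 (by cases b <;> decide)
    have hm : min (x 0 + x 1) (x 1 + x 2 + x 3) = x 1 := by grind
    have hm' : (if b then min (x 1 + x 2 + x 3) (x 3 + x 4) else 0) = x 3 := by
      cases b
      · have := eq_zero_or_of_mem_cone hx 3 3 (by decide)
        simp
        grind
      · have h24 := eq_zero_or_of_mem_cone hx 2 4 (by decide)
        simp only [if_true]
        grind
    have e : cycleCoord b (cycleMap x) = ![x 0 + x 1 - x 1, x 1, x 1 + x 2 + x 3 - x 1 - x 3, x 3,
        x 3 + x 4 - x 3] := by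
      simp only [cycleCoord, cycleMap, LinearMap.coe_mk, AddHom.coe_mk, Matrix.cons_val, hm, hm']
    rw [e]
    ext i
    fin_cases i <;> simp
    ring
  refine ⟨hmaps, hleft.injOn, ?_⟩
  rintro z ⟨hz, hz'⟩
  rw [exists_eq_zero_iff] at hz'
  have h0 := hz 0
  have h1 := hz 1
  have h2 := hz 2
  refine ⟨cycleCoord b z, ⟨?_, ?_⟩, ?_⟩
  · intro i
    fin_cases i <;> simp [cycleCoord] <;> grind
  · have key : ∀ i j, ¬ cycleRel b i j → cycleCoord b z i = 0 ∨ cycleCoord b z j = 0 := by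
      intro i j hij
      cases b <;> fin_cases i <;> fin_cases j <;>
        first
        | exact absurd (by decide) hij
        | (simp [cycleCoord]; done)
        | (simp [cycleCoord]; grind)
    intro i j hi hj
    by_contra h
    exact (key i j h).elim hi hj
  · ext i
    fin_cases i <;> simp [cycleCoord, cycleMap]
    ring

theorem exists_fin_succ_succ_succ {n : ℕ} {p : Fin (n + 3) → Prop} :
    (∃ i, p i) ↔ p 0 ∨ p 1 ∨ p 2 ∨ ∃ i : Fin n, p i.succ.succ.succ := by
  simp only [Fin.exists_fin_succ]
  rfl

theorem forall_fin_succ_succ_succ {n : ℕ} {p : Fin (n + 3) → Prop} :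
    (∀ i, p i) ↔ p 0 ∧ p 1 ∧ p 2 ∧ ∀ i : Fin n, p i.succ.succ.succ := by
  simp only [Fin.forall_fin_succ]
  rfl

/-- The linear map underlying the realization of the join of the boundaries of a triangle and a
simplex as a subdivision of the boundary of a simplex. -/
def joinMap (n : ℕ) : (Fin 3 → ℝ) × (Fin (n + 1) → ℝ) →ₗ[ℝ] (Fin (n + 3) → ℝ) where
  toFun z := Fin.cons (z.1 1 + z.2 0) (Fin.cons (z.1 2 + z.2 0)
    (Fin.cons (z.1 0 + z.2 0) (Fin.tail z.2)))
  map_add' x y := by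
    funext i
    revert i
    exact forall_fin_succ_succ_succ.2 ⟨add_add_add_comm _ _ _ _, add_add_add_comm _ _ _ _,
      add_add_add_comm _ _ _ _, fun i => rfl⟩
  map_smul' c x := by
    funext i
    revert i
    exact forall_fin_succ_succ_succ.2 ⟨(mul_add _ _ _).symm, (mul_add _ _ _).symm,
      (mul_add _ _ _).symm, fun i => rfl⟩

@[simp]
theorem joinMap_zero {n : ℕ} (z : (Fin 3 → ℝ) × (Fin (n + 1) → ℝ)) :
    joinMap n z 0 = z.1 1 + z.2 0 := rfl

@[simp]
theorem joinMap_one {n : ℕ} (z : (Fin 3 → ℝ) × (Fin (n + 1) → ℝ)) :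
    joinMap n z 1 = z.1 2 + z.2 0 := rfl

@[simp]
theorem joinMap_two {n : ℕ} (z : (Fin 3 → ℝ) × (Fin (n + 1) → ℝ)) :
    joinMap n z 2 = z.1 0 + z.2 0 := rfl

@[simp]
theorem joinMap_succ {n : ℕ} (z : (Fin 3 → ℝ) × (Fin (n + 1) → ℝ)) (i : Fin n) :
    joinMap n z i.succ.succ.succ = z.2 i.succ := rfl

/-- Starring the boundary of a simplex σ * τ, with σ a triangle, at an interior point b of σ yields
∂σ * ∂(b * τ). The coordinate of b is `z.2 0`; the σ-part has a vanishing coordinate, so b's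
coordinate is recovered as the minimum of the three coordinates of σ. -/
theorem bijOn_joinMap (n : ℕ) :
    Set.BijOn (joinMap n) (orthantBoundary (Fin 3) ×ˢ orthantBoundary (Fin (n + 1)))
      (orthantBoundary (Fin (n + 3))) := by
  have hmin : ∀ z ∈ (orthantBoundary (Fin 3) ×ˢ orthantBoundary (Fin (n + 1)) :
      Set ((Fin 3 → ℝ) × (Fin (n + 1) → ℝ))),
      min (joinMap n z 2) (min (joinMap n z 0) (joinMap n z 1)) = z.2 0 := by
    rintro ⟨x, y⟩ ⟨⟨hx, hx'⟩, -⟩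
    dsimp only at hx hx'
    have h0 := hx 0
    have h1 := hx 1
    have h2 := hx 2
    rw [exists_eq_zero_iff] at hx'
    simp only [joinMap_zero, joinMap_one, joinMap_two]
    grind
  refine ⟨?_, ?_, ?_⟩
  · rintro ⟨x, y⟩ ⟨⟨hx, hx'⟩, hy, hy'⟩
    dsimp only at hx hx' hy hy'
    rw [exists_eq_zero_iff] at hx'
    have h0 := hx 0
    have h1 := hx 1
    have h2 := hx 2
    have h3 := hy 0
    refine ⟨forall_fin_succ_succ_succ.2 ⟨?_, ?_, ?_, fun i => ?_⟩,
      exists_fin_succ_succ_succ.2 ?_⟩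
    · simp; linarith
    · simp; linarith
    · simp; linarith
    · simpa using hy i.succ
    · simp only [joinMap_zero, joinMap_one, joinMap_two, joinMap_succ]
      rw [Fin.exists_fin_succ] at hy'
      rcases hy' with h | h
      · rw [h]
        rcases hx' with h | h | h <;> simp [h]
      · exact Or.inr (Or.inr (Or.inr h))
  · rintro z hz z' hz' h
    have h2 : z.2 0 = z'.2 0 := by rw [← hmin z hz, ← hmin z' hz', h]
    have e0 := congrFun h 0
    have e1 := congrFun h 1
    have e2 := congrFun h 2
    simp only [joinMap_zero, joinMap_one, joinMap_two] at e0 e1 e2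
    refine Prod.ext (funext fun i => ?_) (funext fun i => ?_)
    · fin_cases i <;> simp <;> linarith
    · refine Fin.cases h2 (fun i => ?_) i
      simpa using congrFun h i.succ.succ.succ
  · rintro z ⟨hz, hz'⟩
    obtain ⟨h0, h1, h2, h3⟩ := forall_fin_succ_succ_succ.1 hz
    rw [exists_fin_succ_succ_succ] at hz'
    refine ⟨(fun i => ![z 2, z 0, z 1] i - min (z 2) (min (z 0) (z 1)),
      Fin.cons (min (z 2) (min (z 0) (z 1))) fun i => z i.succ.succ.succ), ⟨⟨?_, ?_⟩, ?_, ?_⟩, ?_⟩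
    · intro i
      fin_cases i <;> simp
    · rw [exists_eq_zero_iff]
      simp only [Matrix.cons_val]
      grind
    · intro i
      refine Fin.cases ?_ (fun i => ?_) i
      · simp [h0, h1, h2]
      · simpa using h3 i
    · rw [Fin.exists_fin_succ]
      simp only [Fin.cons_zero, Fin.cons_succ]
      rcases hz' with h | h | h | h
      · left; grind
      · left; grind
      · left; grind
      · exact Or.inr h
    · funext i
      revert i
      rw [forall_fin_succ_succ_succ]
      simp

/-- Each `joinMap` absorbs one more triangle boundary. The induction starts from `orthantBoundary
(Fin 1)`, the single point 0, which is the cone over the empty complex. -/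
theorem exists_bijOn_pi_orthantBoundary (k : ℕ) :
    ∃ L : (Fin k → Fin 3 → ℝ) →ₗ[ℝ] (Fin (2 * k + 1) → ℝ),
      Set.BijOn L {x | ∀ i, x i ∈ orthantBoundary (Fin 3)} (orthantBoundary (Fin (2 * k + 1))) := by
  induction k with
  | zero =>
    refine ⟨0, fun x _ => ⟨fun j => le_rfl, 0, rfl⟩, fun x _ y _ _ => Subsingleton.elim _ _, ?_⟩
    rintro y ⟨-, j, hj⟩
    refine ⟨0, fun i => i.elim0, ?_⟩
    ext i
    rw [show i = j from Subsingleton.elim (α := Fin 1) i j, hj]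
    rfl
  | succ k ih =>
    obtain ⟨L, hL⟩ := ih
    let S : (Fin (k + 1) → Fin 3 → ℝ) →ₗ[ℝ] (Fin 3 → ℝ) × (Fin (2 * k + 1) → ℝ) :=
      { toFun := fun x => (x 0, L (Fin.tail x))
        map_add' := fun x y => Prod.ext rfl (L.map_add _ _)
        map_smul' := fun c x => Prod.ext rfl (L.map_smul _ _) }
    have hS : Set.BijOn S {x | ∀ i, x i ∈ orthantBoundary (Fin 3)}
        (orthantBoundary (Fin 3) ×ˢ orthantBoundary (Fin (2 * k + 1))) := by
      refine ⟨fun x hx => ⟨hx 0, hL.mapsTo fun i => hx i.succ⟩, fun x hx y hy h => ?_, ?_⟩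
      · have h0 : x 0 = y 0 := congrArg Prod.fst h
        have h1 : Fin.tail x = Fin.tail y :=
          hL.injOn (fun i => hx i.succ) (fun i => hy i.succ) (congrArg Prod.snd h)
        rw [← Fin.cons_self_tail x, ← Fin.cons_self_tail y, h0, h1]
      · rintro ⟨x, y⟩ ⟨hx, hy⟩
        obtain ⟨x', hx', rfl⟩ := hL.surjOn hy
        refine ⟨Fin.cons x x', fun i => Fin.cases hx hx' i, ?_⟩
        simp [S]
    exact ⟨joinMap (2 * k) ∘ₗ S, (bijOn_joinMap (2 * k)).comp hS⟩

/-- The compatibility relation of a join of quadrilaterals and pentagons. -/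
def cyclesRel {k : ℕ} (s : Fin k → Bool) : Fin k × Fin 5 → Fin k × Fin 5 → Prop :=
  joinRel fun i => cycleRel (s i)

theorem exists_bijOn_cone_cyclesRel {k : ℕ} (s : Fin k → Bool) :
    ∃ M : (Fin k × Fin 5 → ℝ) →ₗ[ℝ] (Fin (2 * k + 1) → ℝ),
      Set.BijOn M (cone (cyclesRel s)) (orthantBoundary (Fin (2 * k + 1))) := by
  obtain ⟨L, hL⟩ := exists_bijOn_pi_orthantBoundary k
  let S : (Fin k × Fin 5 → ℝ) →ₗ[ℝ] (Fin k → Fin 3 → ℝ) :=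
    { toFun := fun x i => cycleMap fun a => x (i, a)
      map_add' := fun x y => funext fun i => cycleMap.map_add (fun a => x (i, a)) fun a => y (i, a)
      map_smul' := fun c x => funext fun i => cycleMap.map_smul c fun a => x (i, a) }
  refine ⟨L ∘ₗ S, hL.comp ⟨?_, ?_, ?_⟩⟩
  · intro x hx i
    exact (bijOn_cycleMap (s i)).mapsTo (mem_cone_joinRel_iff.1 hx i)
  · intro x hx y hy h
    ext ⟨i, a⟩
    exact congrFun ((bijOn_cycleMap (s i)).injOn (mem_cone_joinRel_iff.1 hx i)
      (mem_cone_joinRel_iff.1 hy i) (congrFun h i)) a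
  · intro y hy
    choose x hx hxy using fun i => (bijOn_cycleMap (s i)).surjOn (hy i)
    exact ⟨fun w => x w.1 w.2, mem_cone_joinRel_iff.2 hx, funext hxy⟩

/-! ### Vertex links in joins of cycles -/

/-- Taking a link in a join affects only the factor containing the vertex. -/
theorem linkRel_joinRel {ι α : Type*} [DecidableEq ι] {C : ι → α → α → Prop} {i : ι} {a : α}
    (ha : C i a a) (v w : ι × α) : linkRel (joinRel C) (i, a) v w ↔
      joinRel (Function.update C i (linkRel (C i) a)) v w := by
  obtain ⟨j, b⟩ := v
  obtain ⟨l, c⟩ := w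
  by_cases hj : j = i <;> by_cases hl : l = i
  · subst hj hl
    simp [linkRel, joinRel]
    grind
  · subst hj
    simp [linkRel, joinRel, hl, Ne.symm hl]
    grind
  · subst hl
    simp [linkRel, joinRel, hj, Ne.symm hj]
    grind
  · simp [linkRel, joinRel, hj, hl, Ne.symm hj, Ne.symm hl]
    grind

theorem joinRel_prodShear {ι α : Type*} {C C' : ι → α → α → Prop} (e : ι → α ≃ α)
    (he : ∀ i a b, C i a b ↔ C' i (e i a) (e i b)) (v w : ι × α) :
    joinRel C v w ↔ joinRel C' ((Equiv.refl ι).prodShear e v) ((Equiv.refl ι).prodShear e w) := by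
  obtain ⟨i, a⟩ := v
  obtain ⟨j, b⟩ := w
  simp only [joinRel, Equiv.prodShear_apply, Equiv.refl_apply, he]
  refine and_congr_right fun _ => and_congr_right fun _ => forall_congr' fun h => ?_
  subst h
  rfl

theorem cycleRel_symm {b : Bool} {x y : Fin 5} (h : cycleRel b x y) : cycleRel b y x := by
  revert b x y
  decide

theorem cyclesRel_symm {k : ℕ} {s : Fin k → Bool} {v w : Fin k × Fin 5} (h : cyclesRel s v w) :
    cyclesRel s w v := by
  refine ⟨h.2.1, h.1, fun hvw => ?_⟩
  have := cycleRel_symm (h.2.2 hvw.symm)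
  rwa [← hvw] at this

theorem cyclesRel_self_iff {k : ℕ} {s : Fin k → Bool} {w : Fin k × Fin 5} :
    cyclesRel s w w ↔ cycleRel (s w.1) w.2 w.2 := by
  simp [cyclesRel, joinRel]

/-- Neither cycle contains a triangle, so the two neighbours of a vertex are not adjacent: every
link is a pair of isolated points, whatever the length of the cycle. -/
theorem exists_linkRel_cycleRel_iff {b : Bool} {a : Fin 5} (ha : cycleRel b a a) :
    ∃ m n : Fin 5, m ≠ n ∧ ∀ x y, linkRel (cycleRel b) a x y ↔ x = y ∧ (x = m ∨ x = n) := by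
  revert b a
  unfold linkRel
  decide

theorem exists_perm_linkRel_cycleRel_iff {b : Bool} {a : Fin 5} (ha : cycleRel b a a) :
    ∃ σ : Equiv.Perm (Fin 5), ∀ x y,
      linkRel (cycleRel b) a x y ↔ σ x = σ y ∧ (σ x = 0 ∨ σ x = 1) := by
  obtain ⟨m, n, hmn, h⟩ := exists_linkRel_cycleRel_iff ha
  obtain ⟨σ, hm, hn⟩ : ∃ σ : Equiv.Perm (Fin 5), σ m = 0 ∧ σ n = 1 := by
    -- First move `m` to 0, then the new position of `n` to 1; the latter is not 0, so 0 stays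
    -- fixed.
    refine ⟨Equiv.swap (Equiv.swap m 0 n) 1 * Equiv.swap m 0, ?_, ?_⟩
    · rw [Equiv.Perm.mul_apply, Equiv.swap_apply_left]
      refine Equiv.swap_apply_of_ne_of_ne (fun h0 => hmn ?_) (by decide)
      exact (Equiv.swap m 0).injective ((Equiv.swap_apply_left m 0).trans h0)
    · rw [Equiv.Perm.mul_apply, Equiv.swap_apply_left]
  refine ⟨σ, fun x y => ?_⟩
  rw [h, σ.injective.eq_iff, ← hm, ← hn, σ.injective.eq_iff, σ.injective.eq_iff]

theorem exists_perm_linkRel_cycleRel {b b' : Bool} {a a' : Fin 5} (ha : cycleRel b a a)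
    (ha' : cycleRel b' a' a') : ∃ σ : Equiv.Perm (Fin 5), ∀ x y,
      linkRel (cycleRel b) a x y ↔ linkRel (cycleRel b') a' (σ x) (σ y) := by
  obtain ⟨σ, h⟩ := exists_perm_linkRel_cycleRel_iff ha
  obtain ⟨τ, h'⟩ := exists_perm_linkRel_cycleRel_iff ha'
  exact ⟨σ.trans τ.symm, fun x y => by simp [h, h']⟩

/-- The link of a vertex in a join of quadrilaterals and pentagons does not depend on the cycle
that contains the vertex. -/
theorem combEquiv_link {k : ℕ} {s s' : Fin k → Bool} {K L : FiniteSimplicialComplex}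
    {p : Fin k × Fin 5 → K.Ambient} {q : Fin k × Fin 5 → L.Ambient}
    (hK : IsModel K (cyclesRel s) p) (hL : IsModel L (cyclesRel s') q) {i : Fin k}
    (hs : ∀ j, j ≠ i → s j = s' j) {a a' : Fin 5} (ha : cycleRel (s i) a a)
    (ha' : cycleRel (s' i) a' a') : CombEquiv (K.link (p (i, a))) (L.link (q (i, a'))) := by
  obtain ⟨σ, hσ⟩ := exists_perm_linkRel_cycleRel ha ha'
  refine (hK.link (fun _ _ => cyclesRel_symm) (cyclesRel_self_iff.2 ha)).combEquiv
    (hL.link (fun _ _ => cyclesRel_symm) (cyclesRel_self_iff.2 ha'))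
    ((Equiv.refl (Fin k)).prodShear (Function.update (fun _ => Equiv.refl (Fin 5)) i σ))
    fun v w => ?_
  rw [cyclesRel, cyclesRel, linkRel_joinRel (C := fun i => cycleRel (s i)) ha,
    linkRel_joinRel (C := fun i => cycleRel (s' i)) ha']
  refine joinRel_prodShear _ (fun j b c => ?_) v w
  by_cases hj : j = i
  · subst hj
    simpa using hσ b c
  · simp [hj, hs j hj]

/-! ### The cancelling weighted sum over all joins -/

/-- Vertices are the self-related indices; for the quadrilateral, 3 is excluded. -/
theorem card_filter_cycleRel (b : Bool) :
    (Finset.univ.filter fun a => cycleRel b a a).card = if b then 5 else 4 := by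
  revert b
  decide

/-- A weighted sum in which the contributions of `s` and of `s` changed at `i` cancel. -/
theorem sum_weight_mul_eq_zero {k : ℕ} (i : Fin k) (c n : Bool → ℝ)
    (hcn : c true * n true + c false * n false = 0) (α : (Fin k → Bool) → ℝ)
    (hα : ∀ s b, α (Function.update s i b) = α s) :
    ∑ s : Fin k → Bool, (∏ j, c (s j)) * (n (s i) * α s) = 0 := by
  classical
  -- Flipping `s` at `i` leaves `α` and the other factors unchanged, so paired terms cancel by
  -- `hcn`.
  refine Finset.sum_involution (fun s _ => Function.update s i (!s i)) ?_ ?_ ?_ ?_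
  · intro s _
    rw [hα]
    have h1 : ∏ j, c (s j) = c (s i) * ∏ j ∈ Finset.univ.erase i, c (s j) :=
      (Finset.mul_prod_erase _ _ (Finset.mem_univ i)).symm
    have h2 : ∏ j, c (Function.update s i (!s i) j) =
        c (!s i) * ∏ j ∈ Finset.univ.erase i, c (s j) := by
      rw [← Finset.mul_prod_erase _ _ (Finset.mem_univ i), Function.update_self]
      congr 1
      refine Finset.prod_congr rfl fun j hj => ?_
      rw [Function.update_of_ne (Finset.ne_of_mem_erase hj)]
    rw [h1, h2, Function.update_self]
    have h3 : c (s i) * n (s i) + c (!s i) * n (!s i) = 0 := by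
      cases s i
      · simpa [add_comm] using hcn
      · simpa using hcn
    linear_combination ((∏ j ∈ Finset.univ.erase i, c (s j)) * α s) * h3
  · intro s _ _ h
    have := congrFun h i
    simp at this
  · intro s _
    exact Finset.mem_univ _
  · intro s _
    simp

theorem sum_prod_bool {k : ℕ} (c : Bool → ℝ) :
    ∑ s : Fin k → Bool, ∏ j, c (s j) = (c true + c false) ^ k := by
  classical
  have h := Finset.prod_univ_sum (fun _ : Fin k => (Finset.univ : Finset Bool)) fun _ b => c b
  simp only [Fintype.sum_bool, Finset.prod_const, Finset.card_univ, Fintype.card_fin,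
    Fintype.piFinset_univ] at h
  exact h.symm

/-- The constant function `1` is not combinatorially locally determined on a set that contains all
flag spheres of some odd dimension. -/
theorem not_isCombLocallyDetermined_one (T : Set FiniteSimplicialComplex) (m : ℕ)
    (hT : ∀ K : FiniteSimplicialComplex, K.IsFlag → K.IsSphere (2 * m + 1) → K ∈ T) :
    ¬ IsCombLocallyDetermined T fun _ => 1 := by
  rintro ⟨h, hinv, hsum⟩
  have hex : ∀ s : Fin (m + 1) → Bool, ∃ (K : FiniteSimplicialComplex)
      (p : Fin (m + 1) × Fin 5 → K.Ambient), K ∈ T ∧ IsModel K (cyclesRel s) p := by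
    intro s
    obtain ⟨M, hM⟩ := exists_bijOn_cone_cyclesRel s
    obtain ⟨K, p, hKs, hKm⟩ := exists_isSphere_isModel (d := 2 * m + 1) hM
    exact ⟨K, p, hT K hKm.isFlag hKs, hKm⟩
  choose K p hKT hKm using hex
  let g : ∀ s, {w // cyclesRel s w w} → ℝ := fun s w =>
    h ⟨(K s).link ((hKm s).vertsEquiv w).1,
      link_mem_linksOf ⟨K s, hKT s⟩ ((hKm s).vertsEquiv w)⟩
  have hg : ∀ s s' i, (∀ j, j ≠ i → s j = s' j) → ∀ a a' (ha : cyclesRel s (i, a) (i, a))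
      (ha' : cyclesRel s' (i, a') (i, a')), g s ⟨(i, a), ha⟩ = g s' ⟨(i, a'), ha'⟩ :=
    fun s s' i hss a a' ha ha' => hinv _ _ (combEquiv_link (hKm s) (hKm s') hss
      (cyclesRel_self_iff.1 ha) (cyclesRel_self_iff.1 ha'))
  have hzero : ∀ (s : Fin (m + 1) → Bool) (i : Fin (m + 1)), cyclesRel s (i, 0) (i, 0) := by
    intro s i
    rw [cyclesRel_self_iff]
    change cycleRel (s i) 0 0
    generalize s i = b
    revert b
    decide
  -- Index 0 is a vertex of both cycles, so it serves as representative of every cycle `i`.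
  let α : Fin (m + 1) → (Fin (m + 1) → Bool) → ℝ := fun i s => g s ⟨(i, 0), hzero s i⟩
  have hα : ∀ i s b, α i (Function.update s i b) = α i s := fun i s b =>
    hg _ _ i (fun j hj => Function.update_of_ne hj _ _) _ _ _ _
  have hone : ∀ s, ∑ i, (if s i then (5 : ℝ) else 4) * α i s = 1 := by
    intro s
    classical
    have h1 : (1 : ℝ) = ∑ w, g s w :=
      (hsum ⟨K s, hKT s⟩).trans ((hKm s).vertsEquiv.sum_comp _).symm
    have h2 : ∀ w, g s w = α w.1.1 s := fun w =>
      hg s s w.1.1 (fun _ _ => rfl) w.1.2 0 w.2 (hzero s _)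
    rw [h1, Finset.sum_congr rfl fun w _ => h2 w,
      ← Finset.sum_subtype (Finset.univ.filter fun w => cyclesRel s w w) (by simp)
        (fun w => α w.1 s), Finset.sum_filter, Fintype.sum_prod_type]
    refine Finset.sum_congr rfl fun i _ => ?_
    simp only [cyclesRel_self_iff]
    rw [← Finset.sum_filter, Finset.sum_const, card_filter_cycleRel]
    cases s i <;> simp
  -- The weights -4 and 5 are chosen so that (-4)·5 + 5·4 = 0 while -4 + 5 = 1 ≠ 0.
  have htotal := sum_prod_bool (k := m + 1) fun b => if b then (-4 : ℝ) else 5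
  have hvanish : ∑ s : Fin (m + 1) → Bool, ∏ j, (if s j then (-4 : ℝ) else 5) = 0 := by
    rw [Finset.sum_congr rfl fun s _ => by
      rw [← mul_one (∏ j, (if s j then (-4 : ℝ) else 5)), ← hone s, Finset.mul_sum],
      Finset.sum_comm]
    exact Finset.sum_eq_zero fun i _ =>
      sum_weight_mul_eq_zero i (fun b => if b then (-4 : ℝ) else 5)
        (fun b => if b then (5 : ℝ) else 4) (by norm_num) (α i) (hα i)
  rw [hvanish] at htotal
  norm_num at htotal

end FiniteSimplicialComplex

theorem theorem1 (T : Set FiniteSimplicialComplex) (Λ : T → ℝ) (b : ℤ → ℝ)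
    (hΛ : ∀ K : T, Λ K = ∑ i ∈ Finset.Icc (-1) K.1.dim, b i * (K.1.f i : ℝ)) :
    ((∃ E : ℤ, E ≠ 0 ∧ ∀ K ∈ T, K.eulerChar = E) →
      FiniteSimplicialComplex.IsCombLocallyDetermined T Λ) ∧
    (b (-1) = 0 → FiniteSimplicialComplex.IsCombLocallyDetermined T Λ) ∧
    (b (-1) ≠ 0 →
      (∃ d : ℕ, Odd d ∧ 3 ≤ d ∧
        ∀ K : FiniteSimplicialComplex, K.IsFlag → K.IsSphere d → K ∈ T) →
      ¬ FiniteSimplicialComplex.IsCombLocallyDetermined T Λ) := by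
  refine ⟨?_, ?_, ?_⟩
  · rintro ⟨E, hE, hT⟩
    exact FiniteSimplicialComplex.isCombLocallyDetermined_of_eulerChar_eq T Λ b hΛ hE hT
  · exact FiniteSimplicialComplex.isCombLocallyDetermined_of_eq_zero T Λ b hΛ
  · rintro hb ⟨d, ⟨m, rfl⟩, -, hT⟩ h
    exact FiniteSimplicialComplex.not_isCombLocallyDetermined_one T m hT
      (FiniteSimplicialComplex.exists_isCombLocallyDeterminedBy_one T Λ b hΛ hb h)
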